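/- Every finite non-identity group $R$ has at most $$7.3722\cdot |R|^{\frac{\log_2 |R|}{4}+1.5315}$$ subgroups. -/

import Mathlib

/-! Let `N(K)` count the subgroups of order `h` above `K`, with `|R| = r`. Each such `H ≠ K` has at
least `h/2` elements outside `K`, and adjoining one at least doubles `|K|`. So double counting gives
`N(K) ≤ (2r/h) · max N(K ⊔ ⟨x⟩)`, and induction upwards on `K` yields `card_overgroups_le`. Take `K
= ⊥`, maximise over `h`, and sum over at most `r` orders. -/

open Finset in
/-- Double counting of the pairs `(H, x)` with `K ≤ H`, `|H| = h` and `x ∈ H \ K`. -/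
theorem card_overgroups_mul_le {R : Type*} [Group R] [Fintype R] [Fintype (Subgroup R)]
    [DecidableEq (Subgroup R)] [∀ H K : Subgroup R, Decidable (K ≤ H)]
    [∀ (H : Subgroup R) (x : R), Decidable (x ∈ H)]
    (K : Subgroup R) (h : ℕ) :
    #{H : Subgroup R | K ≤ H ∧ Nat.card H = h} * (h - Nat.card K) ≤
      ∑ x : R with x ∉ K,
        #{H : Subgroup R | K ⊔ Subgroup.zpowers x ≤ H ∧ Nat.card H = h} := by
  classical
  have key := sum_card_bipartiteAbove_eq_sum_card_bipartiteBelow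
    (s := {H : Subgroup R | K ≤ H ∧ Nat.card H = h}) (t := {x : R | x ∉ K})
    (fun (H : Subgroup R) (x : R) => x ∈ H)
  calc _ = ∑ H : Subgroup R with K ≤ H ∧ Nat.card H = h, (h - Nat.card K) := by
        rw [sum_const, smul_eq_mul]
    _ ≤ _ := sum_le_sum fun H hH => ?_
    _ = _ := key
    _ ≤ _ := sum_le_sum fun x _ => card_le_card fun H hH => ?_
  · simp only [mem_filter, mem_univ, true_and] at hH
    have hc : ∀ L : Subgroup R, #{x : R | x ∈ L} = Nat.card L := fun L => by
      rw [Nat.card_eq_fintype_card, Fintype.card_subtype]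
    have hs : #(({x : R | x ∈ H} : Finset R) \ ({x : R | x ∈ K} : Finset R)) = h - Nat.card K := by
      rw [card_sdiff_of_subset, hc, hc, hH.2]
      intro x
      simpa using fun hx => hH.1 hx
    rw [← hs]
    refine card_le_card fun x hx => ?_
    simp only [mem_sdiff, mem_filter, mem_univ, true_and] at hx
    simp [bipartiteAbove, hx.1, hx.2]
  · simp only [bipartiteBelow, mem_filter, mem_univ, true_and] at hH ⊢
    exact ⟨sup_le hH.1.1 (by simpa using hH.2), hH.1.2⟩

open Finset in
/-- In a group of order `r`, a subgroup of order `k` lies in at most `(2r/h) ^ log₂ (h/k)`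
subgroups of order `h`. -/
theorem card_overgroups_le {R : Type*} [Group R] [Fintype R] [Fintype (Subgroup R)]
    [DecidableEq (Subgroup R)] [∀ H K : Subgroup R, Decidable (K ≤ H)]
    (h : ℕ) (K : Subgroup R) :
    (#{H : Subgroup R | K ≤ H ∧ Nat.card H = h} : ℝ) ≤
      (2 * Nat.card R / h : ℝ) ^ Real.logb 2 (h / Nat.card K : ℝ) := by
  classical
  induction K using WellFoundedGT.induction with
  | ind K ih =>
    -- A witness `H₀` forces `h ≤ r`, so the base `2r/h` is at least 1 and powers of it grow with
    -- the exponent.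
    rcases Finset.eq_empty_or_nonempty
      ({H : Subgroup R | K ≤ H ∧ Nat.card H = h} : Finset (Subgroup R)) with he | ⟨H₀, hH₀⟩
    · rw [he]
      simp only [card_empty, Nat.cast_zero]
      positivity
    simp only [mem_filter, mem_univ, true_and] at hH₀
    obtain ⟨hKH, rfl⟩ := hH₀
    have hkpos : 0 < Nat.card K := Nat.card_pos
    have hhpos : 0 < Nat.card H₀ := Nat.card_pos
    have hk0 : (0 : ℝ) < Nat.card K := by exact_mod_cast hkpos
    have hh0 : (0 : ℝ) < Nat.card H₀ := by exact_mod_cast hhpos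
    have hr : (Nat.card H₀ : ℝ) ≤ Nat.card R := by
      exact_mod_cast Subgroup.card_le_card_group H₀
    rcases eq_or_lt_of_le hKH with rfl | hlt
    · rw [div_self hk0.ne', Real.logb_one, Real.rpow_zero]
      have : #{H : Subgroup R | K ≤ H ∧ Nat.card H = Nat.card K} ≤ 1 := by
        refine card_le_one.2 fun A hA B hB => ?_
        simp only [mem_filter, mem_univ, true_and] at hA hB
        rw [← Subgroup.eq_of_le_of_card_ge hA.1 hA.2.le,
          ← Subgroup.eq_of_le_of_card_ge hB.1 hB.2.le]
      exact_mod_cast this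
    have two_mul_le : ∀ L : Subgroup R, K < L → 2 * Nat.card K ≤ Nat.card L := fun L hL => by
      obtain ⟨c, hc⟩ := Subgroup.card_dvd_of_le hL.le
      have hne : Nat.card L ≠ Nat.card K := fun e =>
        hL.ne (Subgroup.eq_of_le_of_card_ge hL.le e.le)
      have hLpos : 0 < Nat.card L := Nat.card_pos
      rcases c with _ | _ | c
      · omega
      · omega
      · rw [hc]; nlinarith
    set B : ℝ := 2 * Nat.card R / Nat.card H₀ with hB
    have hB1 : 1 ≤ B := by rw [hB, le_div_iff₀ hh0]; linarith
    set e : ℝ := Real.logb 2 (Nat.card H₀ / Nat.card K : ℝ) with he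
    have hstep : ∀ x ∉ K,
        (#{H : Subgroup R | K ⊔ Subgroup.zpowers x ≤ H ∧ Nat.card H = Nat.card H₀} : ℝ) ≤
          B ^ (e - 1) := fun x hx => by
      have hlt' : K < K ⊔ Subgroup.zpowers x := by
        simpa using hx
      refine (ih _ hlt').trans (Real.rpow_le_rpow_of_exponent_le hB1 ?_)
      have h2 : (2 : ℝ) * Nat.card K ≤ Nat.card (K ⊔ Subgroup.zpowers x : Subgroup R) := by
        exact_mod_cast two_mul_le _ hlt'
      have h3 : e - 1 = Real.logb 2 (Nat.card H₀ / (2 * Nat.card K) : ℝ) := by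
        rw [he, mul_comm, ← div_div, Real.logb_div (by positivity) two_ne_zero,
          Real.logb_self_eq_one one_lt_two]
      rw [h3]
      refine Real.logb_le_logb_of_le one_lt_two ?_ ?_
      · exact div_pos hh0 (by linarith)
      · exact div_le_div_of_nonneg_left hh0.le (by positivity) h2
    have hcount := card_overgroups_mul_le K (Nat.card H₀)
    have hsum : (∑ x : R with x ∉ K, (#{H : Subgroup R | K ⊔ Subgroup.zpowers x ≤ H ∧
        Nat.card H = Nat.card H₀} : ℝ)) ≤ Nat.card R * B ^ (e - 1) := by
      refine (sum_le_card_nsmul _ _ _ fun x hx => hstep x (by simpa using hx)).trans ?_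
      rw [nsmul_eq_mul]
      refine mul_le_mul_of_nonneg_right ?_ (by positivity)
      rw [Nat.card_eq_fintype_card]
      exact_mod_cast card_le_univ _
    have hhalf : (2 : ℝ) * Nat.card K ≤ Nat.card H₀ := by exact_mod_cast two_mul_le _ hlt
    have hcount' := (Nat.cast_le (α := ℝ)).2 hcount
    rw [Nat.cast_mul, Nat.cast_sub (by have := two_mul_le _ hlt; omega), Nat.cast_sum] at hcount'
    have hBe : B ^ e = B * B ^ (e - 1) := by
      rw [Real.rpow_sub_one (by positivity)]
      field_simp
    rw [hBe, hB, div_mul_eq_mul_div, le_div_iff₀ hh0, ← hB]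
    have hS : (0 : ℝ) ≤ #{H : Subgroup R | K ≤ H ∧ Nat.card H = Nat.card H₀} := by positivity
    -- `h - |K| ≥ h/2` is the source of the factor 2 in the base.
    nlinarith [mul_le_mul_of_nonneg_left hhalf hS]

open Finset in
/-- In a group of order `r` there are at most `2 ^ ((log₂ r + 1)² / 4)` subgroups of any given
order. -/
theorem card_subgroups_of_card_le {R : Type*} [Group R] [Fintype R] [Fintype (Subgroup R)]
    [DecidableEq (Subgroup R)] (h : ℕ) :
    (#{H : Subgroup R | Nat.card H = h} : ℝ) ≤
      (2 : ℝ) ^ ((Real.logb 2 (Nat.card R) + 1) ^ 2 / 4) := by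
  classical
  rcases h.eq_zero_or_pos with rfl | hpos
  · rw [filter_false_of_mem fun H _ => (Nat.card_pos (α := H)).ne']
    simp only [card_empty, Nat.cast_zero]
    positivity
  have hmain := card_overgroups_le h (⊥ : Subgroup R)
  simp only [bot_le, true_and, Subgroup.card_bot, Nat.cast_one, div_one] at hmain
  refine hmain.trans ?_
  have hh0 : (0 : ℝ) < h := by exact_mod_cast hpos
  have hr0 : (0 : ℝ) < Nat.card R := by exact_mod_cast Nat.card_pos (α := R)
  have hbase : (2 * Nat.card R / h : ℝ) =
      (2 : ℝ) ^ (1 + Real.logb 2 (Nat.card R) - Real.logb 2 h) := by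
    rw [Real.rpow_sub two_pos, Real.rpow_add two_pos, Real.rpow_one,
      Real.rpow_logb two_pos (by norm_num) hr0, Real.rpow_logb two_pos (by norm_num) hh0]
  rw [hbase, ← Real.rpow_mul two_pos.le]
  refine Real.rpow_le_rpow_of_exponent_le one_le_two ?_
  -- AM-GM: `(n + 1 - m) m ≤ (n + 1)² / 4` with `n = log₂ r`, `m = log₂ h`.
  nlinarith [sq_nonneg (Real.logb 2 (Nat.card R) + 1 - 2 * Real.logb 2 h)]

theorem theorem1 {R : Type*} [Group R] [Finite R] (hR : Nontrivial R) :
    (Nat.card (Subgroup R) : ℝ) ≤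
      (7.3722 : ℝ) * (Nat.card R : ℝ) ^ (Real.logb 2 (Nat.card R : ℝ) / 4 + (1.5315 : ℝ)) := by
  classical
  have := Fintype.ofFinite R
  have := Fintype.ofFinite (Subgroup R)
  have hr0 : (0 : ℝ) < Nat.card R := by exact_mod_cast Nat.card_pos (α := R)
  have hr1 : (1 : ℝ) ≤ Nat.card R := by exact_mod_cast Nat.card_pos (α := R)
  set n : ℝ := Real.logb 2 (Nat.card R) with hn
  have hn0 : 0 ≤ n := Real.logb_nonneg one_lt_two hr1
  have hrn : (Nat.card R : ℝ) = (2 : ℝ) ^ n := (Real.rpow_logb two_pos (by norm_num) hr0).symm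
  have hmaps : ∀ H ∈ (Finset.univ : Finset (Subgroup R)),
      Nat.card H ∈ Finset.Icc 1 (Nat.card R) := fun H _ =>
    Finset.mem_Icc.2 ⟨Nat.card_pos, Subgroup.card_le_card_group H⟩
  have htotal : (Nat.card (Subgroup R) : ℝ) ≤ Nat.card R * (2 : ℝ) ^ ((n + 1) ^ 2 / 4) := by
    rw [Nat.card_eq_fintype_card (α := Subgroup R), ← Finset.card_univ,
      Finset.card_eq_sum_card_fiberwise hmaps, Nat.cast_sum]
    refine (Finset.sum_le_card_nsmul _ _ _ fun h _ => card_subgroups_of_card_le h).trans ?_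
    rw [Nat.card_Icc, Nat.add_sub_cancel, nsmul_eq_mul]
  refine htotal.trans ?_
  rw [hrn, ← Real.rpow_mul two_pos.le, ← Real.rpow_add two_pos]
  -- The exponent is `n²/4 + 3n/2 + 1/4`, so both stated constants have slack.
  calc (2 : ℝ) ^ (n + (n + 1) ^ 2 / 4)
      ≤ (2 : ℝ) ^ (1 + n * (n / 4 + 1.5315)) :=
        Real.rpow_le_rpow_of_exponent_le one_le_two (by nlinarith)
    _ = 2 * (2 : ℝ) ^ (n * (n / 4 + 1.5315)) := by
        rw [Real.rpow_add two_pos, Real.rpow_one]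
    _ ≤ _ := mul_le_mul_of_nonneg_right (by norm_num) (by positivity)
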